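/- Let $L,P,K$ be finite sets (edges, operators, line pools). Let $c_\ell>0$ be the capacity of edge $\ell\in L$, and for each $k\in K$ let $R(k)\in\{0,1\}^{L\times P}$ be the routing matrix of pool $k$. Fix bids $w_{p,k}\ge 0$ and capacity proportions $f_k>0$. For a price vector $\Lambda=(\Lambda_{\ell,k})\ge 0$ put $\mu_{p,k}(\Lambda)=\sum_{\ell}\Lambda_{\ell,k}R_{\ell,p}(k)$, $x_{p,k}(\Lambda)=w_{p,k}/\mu_{p,k}(\Lambda)$ (read as $0$ if $w_{p,k}=0$) and $y_{\ell,k}(\Lambda)=\sum_p R_{\ell,p}(k)\,x_{p,k}(\Lambda)$. Consider the convex program, with $w$ and $f$ fixed and $0\log 0=0$, $$\max \sum_{p,k} w_{p,k}\log x_{p,k}\quad\text{s.t.}\quad \sum_{p}R_{\ell,p}(k)\,x_{p,k}\le c_\ell f_k\ \ \forall(\ell,k),\qquad x\ge 0 .$$ Call $\bar\Lambda\ge 0$ an optimal price vector for $(w,f)$ if it is a vector of Lagrange multipliers of the capacity constraints at an optimal solution $\bar x$ of this program, that is, $\mu_{p,k}(\bar\Lambda)\,\bar x_{p,k}=w_{p,k}$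 for all $(p,k)$ and $\bar\Lambda_{\ell,k}\bigl(\sum_p R_{\ell,p}(k)\bar x_{p,k}-c_\ell f_k\bigr)=0$ for all $(\ell,k)$. Let $\Lambda:[0,\infty)\to\mathbb{R}_{\ge 0}^{L\times K}$ be any solution of the resource price updating scheme: $\Lambda$ is absolutely continuous on bounded intervals and, for almost every $t>0$, one has $\mu_{p,k}(\Lambda(t))>0$ whenever $w_{p,k}>0$, and for all $(\ell,k)$ $$\dot\Lambda_{\ell,k}(t)=\begin{cases} y_{\ell,k}(\Lambda(t))-c_\ell f_k & \text{if }\Lambda_{\ell,k}(t)>0,\\ \max\{0,\;y_{\ell,k}(\Lambda(t))-c_\ell f_k\} & \text{if }\Lambda_{\ell,k}(t)=0.\end{cases}$$ Then, as $t\to\infty$, $\Lambda(t)$ converges to an optimal price vector for $(w,f)$ (so to the optimal price vector, whenever it is unique). Moreover, for every optimal price vector $\bar\Lambda$ for $(w,f)$, the function $t\mapsto \tfrac12\|\Lambda(t)-\bar\Lambda\|^2$ (Euclidean norm) is nonincreasing on $[0,\infty)$. -/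

import Mathlib

namespace LinePlanning

noncomputable section

/-- End-to-end unit price `μ_{p,k}(Λ) = ∑_ℓ Λ_{ℓ,k} R_{ℓ,p}(k)` of the line of operator `p`
in pool `k`. -/
def pathPrice {L P K : Type*} [Fintype L] (R : K → Matrix L P ℝ) (Λ : L → K → ℝ)
    (p : P) (k : K) : ℝ :=
  ∑ ℓ, Λ ℓ k * R k ℓ p

/-- Aggregate frequency `y_{ℓ,k} = ∑_p R_{ℓ,p}(k) x_{p,k}` on edge `ℓ` in pool `k`. -/
def edgeLoad {L P K : Type*} [Fintype P] (R : K → Matrix L P ℝ) (x : P → K → ℝ)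
    (ℓ : L) (k : K) : ℝ :=
  ∑ p, R k ℓ p * x p k

/-- Frequency `x_{p,k} = w_{p,k} / μ_{p,k}(Λ)` bought with the bid `w_{p,k}` at prices `Λ`.
A zero bid buys frequency `0`, whatever the price. For a positive bid the quotient is only used
at positive `μ_{p,k}(Λ)`, see `IsPriceTrajectory`. -/
def boughtFrequency {L P K : Type*} [Fintype L] (R : K → Matrix L P ℝ) (w : P → K → ℝ)
    (Λ : L → K → ℝ) (p : P) (k : K) : ℝ :=
  w p k / pathPrice R Λ p k

/-- Right-hand side of the projected price updating scheme at a nonnegative price vector `Λ`: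
`y_{ℓ,k} - c_ℓ f_k` where `Λ_{ℓ,k} > 0`, and `max {0, y_{ℓ,k} - c_ℓ f_k}` where
`Λ_{ℓ,k} = 0`. -/
def priceVelocity {L P K : Type*} [Fintype L] [Fintype P] (R : K → Matrix L P ℝ) (c : L → ℝ)
    (w : P → K → ℝ) (f : K → ℝ) (Λ : L → K → ℝ) (ℓ : L) (k : K) : ℝ :=
  if 0 < Λ ℓ k then edgeLoad R (boughtFrequency R w Λ) ℓ k - c ℓ * f k
  else max 0 (edgeLoad R (boughtFrequency R w Λ) ℓ k - c ℓ * f k)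

/-- `Λ` is a (Carathéodory) solution on `[0, ∞)` of the price updating scheme for bids `w` and
proportions `f`. Since the right-hand side jumps when a price reaches zero, the differential
equation is required at almost every time. The initial prices may be any nonnegative vector. -/
structure IsPriceTrajectory {L P K : Type*} [Fintype L] [Fintype P] (R : K → Matrix L P ℝ)
    (c : L → ℝ) (w : P → K → ℝ) (f : K → ℝ) (Λ : ℝ → L → K → ℝ) : Prop where
  nonneg : ∀ t, 0 ≤ t → ∀ ℓ k, 0 ≤ Λ t ℓ k
  absolutelyContinuous : ∀ T, 0 ≤ T → ∀ ℓ k,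
    AbsolutelyContinuousOnInterval (fun t => Λ t ℓ k) 0 T
  /-- The right-hand side is defined: every operator with a positive bid faces a positive price. -/
  defined : ∀ᵐ t : ℝ, 0 < t → ∀ p k, 0 < w p k → 0 < pathPrice R (Λ t) p k
  hasDerivAt : ∀ᵐ t : ℝ, 0 < t → ∀ ℓ k,
    HasDerivAt (fun s => Λ s ℓ k) (priceVelocity R c w f (Λ t) ℓ k) t

/-- Feasible frequencies for fixed proportions `f`. The condition `pos` says that the objective
`∑ w_{p,k} log x_{p,k}` is finite (with `0 · log 0 = 0`). -/
structure IsFeasible {L P K : Type*} [Fintype P] (R : K → Matrix L P ℝ)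
    (c : L → ℝ) (w : P → K → ℝ) (f : K → ℝ) (x : P → K → ℝ) : Prop where
  nonneg : ∀ p k, 0 ≤ x p k
  pos : ∀ p k, 0 < w p k → 0 < x p k
  capacity : ∀ ℓ k, edgeLoad R x ℓ k ≤ c ℓ * f k

/-- The pseudo-utility `∑_{p,k} w_{p,k} log x_{p,k}`. -/
def pseudoUtility {P K : Type*} [Fintype P] [Fintype K] (w x : P → K → ℝ) : ℝ :=
  ∑ p, ∑ k, w p k * Real.log (x p k)

/-- `x` maximizes the pseudo-utility over the feasible frequencies, for fixed `w` and `f`. -/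
def IsOptimalFrequency {L P K : Type*} [Fintype P] [Fintype K] (R : K → Matrix L P ℝ)
    (c : L → ℝ) (w : P → K → ℝ) (f : K → ℝ) (x : P → K → ℝ) : Prop :=
  IsFeasible R c w f x ∧
    ∀ x', IsFeasible R c w f x' → pseudoUtility w x' ≤ pseudoUtility w x

/-- `Λ` is an optimal price vector for bids `w` and proportions `f`: a vector of Lagrange
multipliers of the capacity constraints at an optimal frequency vector. Stationarity
`w_{p,k} / x_{p,k} = μ_{p,k}(Λ)` is written as a product, so that it also is the
Karush–Kuhn–Tucker condition (for `x_{p,k} ≥ 0`) of a zero bid. -/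
def IsOptimalPrice {L P K : Type*} [Fintype L] [Fintype P] [Fintype K] (R : K → Matrix L P ℝ)
    (c : L → ℝ) (w : P → K → ℝ) (f : K → ℝ) (Λ : L → K → ℝ) : Prop :=
  (∀ ℓ k, 0 ≤ Λ ℓ k) ∧
    ∃ x, IsOptimalFrequency R c w f x ∧
      (∀ p k, pathPrice R Λ p k * x p k = w p k) ∧
      (∀ ℓ k, Λ ℓ k * (edgeLoad R x ℓ k - c ℓ * f k) = 0)

/-- `V(Λ) = ½ ∑_{ℓ,k} (Λ_{ℓ,k} - Λ'_{ℓ,k})²`. -/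
def lyapunov {L K : Type*} [Fintype L] [Fintype K] (Λ' Λ : L → K → ℝ) : ℝ :=
  1 / 2 * ∑ ℓ, ∑ k, (Λ ℓ k - Λ' ℓ k) ^ 2

end

end LinePlanning

/-!
The squared distance to an optimal price vector is a Lyapunov function: by monotonicity of the
demand `μ ↦ w / μ` and complementary slackness, it decreases at least as fast as a continuous
function of the prices that is nonnegative and vanishes only at optimal prices. Hence orbits are
bounded and the infimum of this function along an orbit is `0`. It is attained in the compact
closure of the orbit, at an optimal price vector, and since the distance to that vector is
nonincreasing too, the whole orbit converges to it.

The argument needs one optimal price vector to start with. Among the nonnegative prices at which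
the capacities cost at most `∑ w`, take a maximizer of `∏ μ ^ w`. Its first-order condition says
that no admissible price vector makes the demand at the maximizer cost more than `∑ w`; testing it
with a single nonzero price shows that the demand respects the capacities.
-/

namespace LinePlanning

open Filter Set MeasureTheory
open scoped Topology

section AbsoluteContinuity

lemma absolutelyContinuousOnInterval_const {X : Type*} [PseudoMetricSpace X] (a b : ℝ) (r : X) :
    AbsolutelyContinuousOnInterval (fun _ => r) a b :=
  (LipschitzWith.const r).lipschitzOnWith.absolutelyContinuousOnInterval

lemma absolutelyContinuousOnInterval_sum {ι F : Type*} [SeminormedAddCommGroup F] (s : Finset ι)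
    {g : ι → ℝ → F} {a b : ℝ} (hg : ∀ i ∈ s, AbsolutelyContinuousOnInterval (g i) a b) :
    AbsolutelyContinuousOnInterval (fun t => ∑ i ∈ s, g i t) a b := by
  classical
  induction s using Finset.induction_on with
  | empty => simpa only [Finset.sum_empty] using absolutelyContinuousOnInterval_const a b (0 : F)
  | insert i s hi ih =>
    simp only [Finset.sum_insert hi]
    exact (hg i (Finset.mem_insert_self i s)).add
      (ih fun j hj => hg j (Finset.mem_insert_of_mem hj))

lemma sub_le_mul_sub_of_ae_deriv_le {g : ℝ → ℝ} {a b C : ℝ} (hab : a ≤ b)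
    (hg : AbsolutelyContinuousOnInterval g a b)
    (hderiv : ∀ᵐ t : ℝ, t ∈ Ioo a b → deriv g t ≤ C) : g b - g a ≤ C * (b - a) := by
  have hae : ∀ᵐ t ∂volume.restrict (Icc a b), deriv g t ≤ C := by
    rwa [← Measure.restrict_congr_set Ioo_ae_eq_Icc, ae_restrict_iff' measurableSet_Ioo]
  calc g b - g a = ∫ t in a..b, deriv g t := hg.integral_deriv_eq_sub.symm
    _ ≤ ∫ _ in a..b, C :=
        intervalIntegral.integral_mono_ae_restrict hab hg.intervalIntegrable_deriv
          intervalIntegrable_const hae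
    _ = C * (b - a) := by rw [intervalIntegral.integral_const, smul_eq_mul, mul_comm]

lemma antitoneOn_Ici_of_ae_deriv_nonpos {g : ℝ → ℝ} {a : ℝ}
    (hg : ∀ b, a ≤ b → AbsolutelyContinuousOnInterval g a b)
    (hderiv : ∀ᵐ t : ℝ, a < t → deriv g t ≤ 0) : AntitoneOn g (Ici a) := by
  intro s hs t ht hst
  have hgst : AbsolutelyContinuousOnInterval g s t := (hg t ht).mono <| by
    rw [uIcc_of_le hst, uIcc_of_le ht]
    exact Icc_subset_Icc_left hs
  have h := sub_le_mul_sub_of_ae_deriv_le hst hgst (C := 0) <| by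
    filter_upwards [hderiv] with r hr hrst using hr (lt_of_le_of_lt hs hrst.1)
  linarith

lemma exists_lt_of_ae_deriv_le_neg {g d : ℝ → ℝ} {a m ε : ℝ}
    (hg : ∀ b, a ≤ b → AbsolutelyContinuousOnInterval g a b) (hm : ∀ t, a ≤ t → m ≤ g t)
    (hderiv : ∀ᵐ t : ℝ, a < t → deriv g t ≤ -d t) (hε : 0 < ε) : ∃ t, a ≤ t ∧ d t < ε := by
  by_contra! hd
  have hdrop : 0 < (g a - m + 1) / ε := div_pos (by linarith [hm a le_rfl]) hε
  set b := a + (g a - m + 1) / ε with hb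
  have hab : a ≤ b := by linarith
  have h := sub_le_mul_sub_of_ae_deriv_le hab (hg b hab) (C := -ε) <| by
    filter_upwards [hderiv] with t ht htab
    exact (ht htab.1).trans (neg_le_neg (hd t htab.1.le))
  have hcancel : ε * (b - a) = g a - m + 1 := by
    rw [hb, add_sub_cancel_left, mul_div_cancel₀ _ hε.ne']
  linarith [hm b hab]

end AbsoluteContinuity

lemma tendsto_of_antitoneOn_of_mem_closure {ι X : Type*} [Preorder ι] [TopologicalSpace X]
    {V : X → ℝ} (hV : Continuous V) {x : X} (hx : ∀ y, V x ≤ V y) {γ : ι → X} {a : ι}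
    (hanti : AntitoneOn (fun t => V (γ t)) (Ici a)) (hmem : x ∈ closure (γ '' Ici a)) :
    Tendsto (fun t => V (γ t)) atTop (𝓝 (V x)) := by
  refine tendsto_order.2 ⟨fun r hr => .of_forall fun t => hr.trans_le (hx _), fun r hr => ?_⟩
  obtain ⟨-, hlt, s, hs, rfl⟩ := mem_closure_iff.1 hmem _ (isOpen_lt hV continuous_const) hr
  filter_upwards [eventually_ge_atTop s] with t hst
  exact (hanti hs (le_trans hs hst) hst).trans_lt hlt

section DoubleSum

variable {ι κ : Type*} [Fintype ι] [Fintype κ]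

lemma le_sum_sum {a : ι → κ → ℝ} (ha : ∀ i j, 0 ≤ a i j) (i : ι) (j : κ) :
    a i j ≤ ∑ i, ∑ j, a i j :=
  calc a i j ≤ ∑ j, a i j := Finset.single_le_sum (fun j _ => ha i j) (Finset.mem_univ j)
    _ ≤ ∑ i, ∑ j, a i j := Finset.single_le_sum (f := fun i => ∑ j, a i j)
        (fun i _ => Finset.sum_nonneg fun j _ => ha i j) (Finset.mem_univ i)

lemma sum_sum_nonneg {a : ι → κ → ℝ} (ha : ∀ i j, 0 ≤ a i j) : 0 ≤ ∑ i, ∑ j, a i j :=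
  Finset.sum_nonneg fun i _ => Finset.sum_nonneg fun j _ => ha i j

lemma eq_zero_of_sum_sum_nonpos {a : ι → κ → ℝ} (ha : ∀ i j, 0 ≤ a i j)
    (hsum : ∑ i, ∑ j, a i j ≤ 0) (i : ι) (j : κ) : a i j = 0 :=
  le_antisymm ((le_sum_sum ha i j).trans hsum) (ha i j)

lemma sum_sum_single_mul [DecidableEq ι] [DecidableEq κ] (g : ι → κ → ℝ) (i : ι) (j : κ)
    (r : ℝ) :
    ∑ i', ∑ j', (Pi.single i (Pi.single j r) : ι → κ → ℝ) i' j' * g i' j' = r * g i j := by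
  rw [Fintype.sum_eq_single i fun i' h => by simp [h],
    Fintype.sum_eq_single j fun j' h => by simp [h]]
  simp

end DoubleSum

section ProportionalFairness

variable {ι : Type*} [Fintype ι] {w : ι → ℝ}

lemma prod_rpow_eq_exp_sum_mul_log (hw : ∀ i, 0 ≤ w i) {ν : ι → ℝ}
    (hν : ∀ i, 0 < w i → 0 < ν i) : ∏ i, ν i ^ w i = Real.exp (∑ i, w i * Real.log (ν i)) := by
  rw [Real.exp_sum]
  refine Finset.prod_congr rfl fun i _ => ?_
  rcases (hw i).eq_or_lt with hwi | hwi
  · simp [← hwi]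
  · rw [Real.rpow_def_of_pos (hν i hwi), mul_comm]

lemma exists_forall_sum_mul_log_le (hw : ∀ i, 0 ≤ w i) {S : Set (ι → ℝ)} (hS : IsCompact S)
    (hnonneg : ∀ ν ∈ S, ∀ i, 0 ≤ ν i) (hpos : ∃ ν ∈ S, ∀ i, 0 < w i → 0 < ν i) :
    ∃ ν ∈ S, (∀ i, 0 < w i → 0 < ν i) ∧ ∀ ν' ∈ S, (∀ i, 0 < w i → 0 < ν' i) →
      ∑ i, w i * Real.log (ν' i) ≤ ∑ i, w i * Real.log (ν i) := by
  obtain ⟨ν₀, hν₀S, hν₀⟩ := hpos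
  have hcont : Continuous fun ν : ι → ℝ => ∏ i, ν i ^ w i :=
    continuous_finsetProd _ fun i _ => (continuous_apply i).rpow_const fun _ => Or.inr (hw i)
  obtain ⟨ν, hνS, hmax⟩ := hS.exists_isMaxOn ⟨ν₀, hν₀S⟩ hcont.continuousOn
  have hprod : 0 < ∏ i, ν i ^ w i := by
    refine lt_of_lt_of_le ?_ (hmax hν₀S)
    simpa only [prod_rpow_eq_exp_sum_mul_log hw hν₀] using Real.exp_pos _
  have hν : ∀ i, 0 < w i → 0 < ν i := fun i hwi =>
    (hnonneg ν hνS i).lt_of_ne' fun h0 => hprod.ne' <|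
      Finset.prod_eq_zero (Finset.mem_univ i) (by rw [h0, Real.zero_rpow hwi.ne'])
  refine ⟨ν, hνS, hν, fun ν' hν'S hν' => Real.exp_le_exp.1 ?_⟩
  rw [← prod_rpow_eq_exp_sum_mul_log hw hν', ← prod_rpow_eq_exp_sum_mul_log hw hν]
  exact hmax hν'S

lemma hasFDerivAt_sum_mul_log {ν : ι → ℝ} (hν : ∀ i, w i ≠ 0 → ν i ≠ 0) :
    HasFDerivAt (fun ν : ι → ℝ => ∑ i, w i * Real.log (ν i))
      (∑ i, (w i / ν i) • ContinuousLinearMap.proj (R := ℝ) (φ := fun _ : ι => ℝ) i) ν := by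
  refine HasFDerivAt.fun_sum fun i _ => ?_
  by_cases hwi : w i = 0
  · simpa [hwi] using hasFDerivAt_const (0 : ℝ) ν
  · simpa only [smul_smul, div_eq_mul_inv] using
      ((hasFDerivAt_apply i ν).log (hν i hwi)).const_mul (w i)

/-- The maximizer of `∑ w log ν` over `S` satisfies this first-order condition. -/
lemma exists_forall_sum_mul_div_le (hw : ∀ i, 0 ≤ w i) {S : Set (ι → ℝ)} (hS : IsCompact S)
    (hconv : Convex ℝ S) (hnonneg : ∀ ν ∈ S, ∀ i, 0 ≤ ν i)
    (hpos : ∃ ν ∈ S, ∀ i, 0 < w i → 0 < ν i) :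
    ∃ ν ∈ S, (∀ i, 0 < w i → 0 < ν i) ∧
      ∀ ν' ∈ S, ∑ i, w i / ν i * ν' i ≤ ∑ i, w i := by
  obtain ⟨ν, hνS, hν, hmax⟩ := exists_forall_sum_mul_log_le hw hS hnonneg hpos
  have hloc : IsLocalMaxOn (fun ν : ι → ℝ => ∑ i, w i * Real.log (ν i)) S ν := by
    have hnear : ∀ᶠ ν' in 𝓝[S] ν, ∀ i, 0 < w i → 0 < ν' i :=
      nhdsWithin_le_nhds <| eventually_all.2 fun i => eventually_imp_distrib_left.2 fun hwi =>
        (continuous_apply i).continuousAt.eventually_const_lt (hν i hwi)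
    filter_upwards [hnear, self_mem_nhdsWithin] with ν' hν' hν'S using hmax ν' hν'S hν'
  refine ⟨ν, hνS, hν, fun ν' hν'S => ?_⟩
  have hfirst := hloc.hasFDerivWithinAt_nonpos
    (hasFDerivAt_sum_mul_log fun i hwi => (hν i ((hw i).lt_of_ne' hwi)).ne').hasFDerivWithinAt
    (sub_mem_posTangentConeAt_of_segment_subset (hconv.segment_subset hνS hν'S))
  have hself : ∀ i, w i / ν i * ν i = w i := fun i =>
    div_mul_cancel_of_imp fun hνi => by
      by_contra hwi
      exact (hν i ((hw i).lt_of_ne' hwi)).ne' hνi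
  simpa [mul_sub, hself] using hfirst

end ProportionalFairness

section Prices

variable {L P K : Type*}

lemma isLinearMap_pathPrice [Fintype L] (R : K → Matrix L P ℝ) :
    IsLinearMap ℝ (pathPrice R) where
  map_add Λ Λ' := by
    ext p k
    simp only [pathPrice, Pi.add_apply, add_mul, Finset.sum_add_distrib]
  map_smul s Λ := by
    ext p k
    simp only [pathPrice, Pi.smul_apply, smul_eq_mul, Finset.mul_sum, mul_assoc]

lemma continuous_pathPrice [Fintype L] (R : K → Matrix L P ℝ) : Continuous (pathPrice R) := by
  unfold pathPrice
  fun_prop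

lemma pathPrice_nonneg [Fintype L] {R : K → Matrix L P ℝ} (hR : ∀ k ℓ p, 0 ≤ R k ℓ p)
    {Λ : L → K → ℝ} (hΛ : ∀ ℓ k, 0 ≤ Λ ℓ k) (p : P) (k : K) : 0 ≤ pathPrice R Λ p k :=
  Finset.sum_nonneg fun ℓ _ => mul_nonneg (hΛ ℓ k) (hR k ℓ p)

lemma edgeLoad_sub [Fintype P] (R : K → Matrix L P ℝ) (x x' : P → K → ℝ) (ℓ : L) (k : K) :
    edgeLoad R (x - x') ℓ k = edgeLoad R x ℓ k - edgeLoad R x' ℓ k := by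
  simp only [edgeLoad, Pi.sub_apply, mul_sub, Finset.sum_sub_distrib]

lemma sum_mul_edgeLoad [Fintype L] [Fintype P] [Fintype K] (R : K → Matrix L P ℝ)
    (Λ : L → K → ℝ) (x : P → K → ℝ) :
    ∑ ℓ, ∑ k, Λ ℓ k * edgeLoad R x ℓ k = ∑ p, ∑ k, pathPrice R Λ p k * x p k := by
  simp only [edgeLoad, pathPrice, Finset.mul_sum, Finset.sum_mul]
  rw [Finset.sum_comm, Finset.sum_comm (s := (Finset.univ : Finset P))]
  refine Finset.sum_congr rfl fun k _ => ?_
  rw [Finset.sum_comm]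
  exact Finset.sum_congr rfl fun p _ => Finset.sum_congr rfl fun ℓ _ => by ring

lemma pathPrice_mul_boughtFrequency [Fintype L] {R : K → Matrix L P ℝ} {w : P → K → ℝ}
    {Λ : L → K → ℝ} {p : P} {k : K} (hw : 0 ≤ w p k)
    (hpos : 0 < w p k → 0 < pathPrice R Λ p k) :
    pathPrice R Λ p k * boughtFrequency R w Λ p k = w p k := by
  unfold boughtFrequency
  rcases hw.eq_or_lt with h | h
  · simp [← h]
  · exact mul_div_cancel₀ _ (hpos h).ne'

end Prices

section Multipliers

variable {L P K : Type*} [Fintype L] [Fintype P]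

/-- `Λ` is a vector of Lagrange multipliers of the capacity constraints at the frequencies `x`.
Feasibility of `x` is kept separate, as it does not involve `Λ`. -/
structure IsMultiplier (R : K → Matrix L P ℝ) (c : L → ℝ) (w : P → K → ℝ) (f : K → ℝ)
    (x : P → K → ℝ) (Λ : L → K → ℝ) : Prop where
  nonneg : ∀ ℓ k, 0 ≤ Λ ℓ k
  stationarity : ∀ p k, pathPrice R Λ p k * x p k = w p k
  slackness : ∀ ℓ k, Λ ℓ k * (edgeLoad R x ℓ k - c ℓ * f k) = 0

variable {R : K → Matrix L P ℝ} {c : L → ℝ} {w : P → K → ℝ} {f : K → ℝ} {x : P → K → ℝ}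
  {Λ : L → K → ℝ}

lemma isOptimalPrice_iff_exists_isMultiplier [Fintype K] :
    IsOptimalPrice R c w f Λ ↔ ∃ x, IsOptimalFrequency R c w f x ∧ IsMultiplier R c w f x Λ :=
  ⟨fun ⟨hΛ, x, hx, hstat, hslack⟩ => ⟨x, hx, hΛ, hstat, hslack⟩,
    fun ⟨x, hx, hm⟩ => ⟨hm.nonneg, x, hx, hm.stationarity, hm.slackness⟩⟩

lemma mul_log_le_mul_log_add_sub {w μ x x' : ℝ} (hw : 0 ≤ w) (hμ : 0 ≤ μ) (hx' : 0 ≤ x')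
    (hpos : 0 < w → 0 < x) (hpos' : 0 < w → 0 < x') (hstat : μ * x = w) :
    w * Real.log x' ≤ w * Real.log x + (μ * x' - w) := by
  rcases hw.eq_or_lt with h | h
  · simpa [← h] using mul_nonneg hμ hx'
  · have hlog : Real.log x' - Real.log x ≤ x' / x - 1 := by
      rw [← Real.log_div (hpos' h).ne' (hpos h).ne']
      exact Real.log_le_sub_one_of_pos (div_pos (hpos' h) (hpos h))
    have heq : w * (x' / x - 1) = μ * x' - w := by
      have := (hpos h).ne'
      rw [← hstat]
      field_simp
    linarith [mul_le_mul_of_nonneg_left hlog hw]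

lemma IsMultiplier.sum_pathPrice_mul_le [Fintype K] (hm : IsMultiplier R c w f x Λ)
    {x' : P → K → ℝ} (hx' : IsFeasible R c w f x') :
    ∑ p, ∑ k, pathPrice R Λ p k * x' p k ≤ ∑ p, ∑ k, w p k := by
  simp only [← hm.stationarity, ← sum_mul_edgeLoad]
  refine Finset.sum_le_sum fun ℓ _ => Finset.sum_le_sum fun k _ => ?_
  linarith [mul_le_mul_of_nonneg_left (hx'.capacity ℓ k) (hm.nonneg ℓ k), hm.slackness ℓ k]

lemma IsMultiplier.isOptimalFrequency [Fintype K] (hm : IsMultiplier R c w f x Λ)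
    (hR : ∀ k ℓ p, 0 ≤ R k ℓ p) (hw : ∀ p k, 0 ≤ w p k) (hx : IsFeasible R c w f x) :
    IsOptimalFrequency R c w f x := by
  refine ⟨hx, fun x' hx' => ?_⟩
  have hutility : pseudoUtility w x' ≤
      pseudoUtility w x + (∑ p, ∑ k, pathPrice R Λ p k * x' p k - ∑ p, ∑ k, w p k) := by
    simp only [pseudoUtility, ← Finset.sum_add_distrib, ← Finset.sum_sub_distrib]
    exact Finset.sum_le_sum fun p _ => Finset.sum_le_sum fun k _ =>
      mul_log_le_mul_log_add_sub (hw p k) (pathPrice_nonneg hR hm.nonneg p k) (hx'.nonneg p k)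
        (hx.pos p k) (hx'.pos p k) (hm.stationarity p k)
  linarith [hm.sum_pathPrice_mul_le hx']

lemma isOptimalPrice_of_edgeLoad_boughtFrequency_le [Fintype K] (hR : ∀ k ℓ p, 0 ≤ R k ℓ p)
    (hw : ∀ p k, 0 ≤ w p k) (hΛ : ∀ ℓ k, 0 ≤ Λ ℓ k)
    (hpos : ∀ p k, 0 < w p k → 0 < pathPrice R Λ p k)
    (hcap : ∀ ℓ k, edgeLoad R (boughtFrequency R w Λ) ℓ k ≤ c ℓ * f k)
    (hslack : ∀ ℓ k, Λ ℓ k * (edgeLoad R (boughtFrequency R w Λ) ℓ k - c ℓ * f k) = 0) :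
    IsOptimalPrice R c w f Λ := by
  have hm : IsMultiplier R c w f (boughtFrequency R w Λ) Λ :=
    ⟨hΛ, fun p k => pathPrice_mul_boughtFrequency (hw p k) (hpos p k), hslack⟩
  have hx : IsFeasible R c w f (boughtFrequency R w Λ) :=
    ⟨fun p k => div_nonneg (hw p k) (pathPrice_nonneg hR hΛ p k),
      fun p k h => div_pos h (hpos p k h), hcap⟩
  exact isOptimalPrice_iff_exists_isMultiplier.2 ⟨_, hm.isOptimalFrequency hR hw hx, hm⟩

end Multipliers

section Budget

variable {L K : Type*} [Fintype L] [Fintype K]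

/-- The nonnegative price vectors at which the capacities `c ℓ * f k` cost at most `W` in total;
optimal price vectors are sought among them. -/
def budgetSet (c : L → ℝ) (f : K → ℝ) (W : ℝ) : Set (L → K → ℝ) :=
  {Λ | (∀ ℓ k, 0 ≤ Λ ℓ k) ∧ ∑ ℓ, ∑ k, Λ ℓ k * (c ℓ * f k) ≤ W}

variable {c : L → ℝ} {f : K → ℝ} {W : ℝ}

lemma convex_budgetSet : Convex ℝ (budgetSet c f W) := by
  have hnonneg : Convex ℝ {Λ : L → K → ℝ | ∀ ℓ k, 0 ≤ Λ ℓ k} := convex_Ici 0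
  refine hnonneg.inter (convex_halfSpace_le ⟨fun Λ Λ' => ?_, fun s Λ => ?_⟩ W)
  · simp only [Pi.add_apply, add_mul, Finset.sum_add_distrib]
  · simp only [Pi.smul_apply, smul_eq_mul, Finset.mul_sum, mul_assoc]

lemma isCompact_budgetSet (hcf : ∀ ℓ k, 0 < c ℓ * f k) : IsCompact (budgetSet c f W) := by
  have hbox : IsCompact (Icc (0 : L → K → ℝ) fun ℓ k => W / (c ℓ * f k)) := isCompact_Icc
  refine hbox.of_isClosed_subset ?_ fun Λ ⟨hΛ, hcost⟩ => ⟨hΛ, fun ℓ k => ?_⟩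
  · have hnonneg : IsClosed {Λ : L → K → ℝ | ∀ ℓ k, 0 ≤ Λ ℓ k} := isClosed_Ici
    have hcont : Continuous fun Λ : L → K → ℝ => ∑ ℓ, ∑ k, Λ ℓ k * (c ℓ * f k) := by fun_prop
    exact hnonneg.inter (isClosed_le hcont continuous_const)
  · rw [le_div_iff₀ (hcf ℓ k)]
    exact (le_sum_sum (a := fun ℓ k => Λ ℓ k * (c ℓ * f k))
      (fun ℓ k => mul_nonneg (hΛ ℓ k) (hcf ℓ k).le) ℓ k).trans hcost

lemma exists_pos_smul_mem_budgetSet (hW : 0 < W) {Λ : L → K → ℝ} (hΛ : ∀ ℓ k, 0 ≤ Λ ℓ k) :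
    ∃ s : ℝ, 0 < s ∧ s • Λ ∈ budgetSet c f W := by
  set C := ∑ ℓ, ∑ k, Λ ℓ k * (c ℓ * f k) with hC
  have hden : 0 < |C| + 1 := by positivity
  refine ⟨W / (|C| + 1), div_pos hW hden,
    fun ℓ k => mul_nonneg (div_pos hW hden).le (hΛ ℓ k), ?_⟩
  simp only [Pi.smul_apply, smul_eq_mul, mul_assoc, ← Finset.mul_sum, ← hC]
  rw [div_mul_eq_mul_div, div_le_iff₀ hden]
  exact mul_le_mul_of_nonneg_left ((le_abs_self C).trans (by linarith)) hW.le

lemma single_mem_budgetSet [DecidableEq L] [DecidableEq K] (hW : 0 ≤ W) {ℓ : L} {k : K}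
    (hcf : 0 < c ℓ * f k) : Pi.single ℓ (Pi.single k (W / (c ℓ * f k))) ∈ budgetSet c f W := by
  have hnonneg : (0 : L → K → ℝ) ≤ Pi.single ℓ (Pi.single k (W / (c ℓ * f k))) :=
    Pi.single_nonneg.2 (Pi.single_nonneg.2 (div_nonneg hW hcf.le))
  refine ⟨hnonneg, ?_⟩
  rw [sum_sum_single_mul (fun ℓ k => c ℓ * f k), div_mul_cancel₀ _ hcf.ne']

end Budget

section Existence

variable {L P K : Type*} [Fintype L] [Fintype P] [Fintype K] {R : K → Matrix L P ℝ} {c : L → ℝ}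
  {w : P → K → ℝ} {f : K → ℝ}

lemma exists_mem_budgetSet_forall_sum_mul_edgeLoad_le (hR : ∀ k ℓ p, 0 ≤ R k ℓ p)
    (hcf : ∀ ℓ k, 0 < c ℓ * f k) (hw : ∀ p k, 0 ≤ w p k) {W : ℝ} (hW : 0 < W)
    {Λ₀ : L → K → ℝ} (hΛ₀ : ∀ ℓ k, 0 ≤ Λ₀ ℓ k)
    (hpos₀ : ∀ p k, 0 < w p k → 0 < pathPrice R Λ₀ p k) :
    ∃ Λ ∈ budgetSet c f W, (∀ p k, 0 < w p k → 0 < pathPrice R Λ p k) ∧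
      ∀ Λ' ∈ budgetSet c f W,
        ∑ ℓ, ∑ k, Λ' ℓ k * edgeLoad R (boughtFrequency R w Λ) ℓ k ≤ ∑ p, ∑ k, w p k := by
  set A : (L → K → ℝ) → P × K → ℝ := fun Λ i => pathPrice R Λ i.1 i.2 with hA
  have hlin : IsLinearMap ℝ A :=
    ⟨fun Λ Λ' => by simp only [hA, (isLinearMap_pathPrice R).map_add]; rfl,
      fun s Λ => by simp only [hA, (isLinearMap_pathPrice R).map_smul]; rfl⟩
  have hcont : Continuous A := continuous_pi fun i =>
    continuous_apply_apply i.1 i.2 |>.comp (continuous_pathPrice R)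
  obtain ⟨s, hs, hsmem⟩ := exists_pos_smul_mem_budgetSet (c := c) (f := f) hW hΛ₀
  have hspos : ∀ i : P × K, 0 < w i.1 i.2 → 0 < A (s • Λ₀) i := fun i hi => by
    rw [hlin.map_smul]
    exact mul_pos hs (hpos₀ i.1 i.2 hi)
  obtain ⟨-, ⟨Λ, hΛ, rfl⟩, hpos, hfair⟩ :=
    exists_forall_sum_mul_div_le (w := fun i : P × K => w i.1 i.2) (fun i => hw i.1 i.2)
      ((isCompact_budgetSet hcf).image hcont) (convex_budgetSet.is_linear_image hlin)
      (forall_mem_image.2 fun Λ hΛ i => pathPrice_nonneg hR hΛ.1 i.1 i.2)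
      ⟨_, mem_image_of_mem A hsmem, hspos⟩
  refine ⟨Λ, hΛ, fun p k => hpos (p, k), fun Λ' hΛ' => ?_⟩
  have h := hfair _ (mem_image_of_mem A hΛ')
  rw [Fintype.sum_prod_type, Fintype.sum_prod_type] at h
  rw [sum_mul_edgeLoad]
  simpa only [boughtFrequency, mul_comm] using h

lemma isOptimalPrice_of_forall_sum_mul_edgeLoad_le (hR : ∀ k ℓ p, 0 ≤ R k ℓ p)
    (hcf : ∀ ℓ k, 0 < c ℓ * f k) (hw : ∀ p k, 0 ≤ w p k) (hW : 0 < ∑ p, ∑ k, w p k)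
    {Λ : L → K → ℝ} (hΛ : Λ ∈ budgetSet c f (∑ p, ∑ k, w p k))
    (hpos : ∀ p k, 0 < w p k → 0 < pathPrice R Λ p k)
    (hfair : ∀ Λ' ∈ budgetSet c f (∑ p, ∑ k, w p k),
      ∑ ℓ, ∑ k, Λ' ℓ k * edgeLoad R (boughtFrequency R w Λ) ℓ k ≤ ∑ p, ∑ k, w p k) :
    IsOptimalPrice R c w f Λ := by
  classical
  have hcap : ∀ ℓ k, edgeLoad R (boughtFrequency R w Λ) ℓ k ≤ c ℓ * f k := fun ℓ k => by
    have h := hfair _ (single_mem_budgetSet hW.le (hcf ℓ k))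
    rw [sum_sum_single_mul, div_mul_eq_mul_div, div_le_iff₀ (hcf ℓ k)] at h
    exact le_of_mul_le_mul_left h hW
  have hpaid : ∑ ℓ, ∑ k, Λ ℓ k * edgeLoad R (boughtFrequency R w Λ) ℓ k = ∑ p, ∑ k, w p k := by
    rw [sum_mul_edgeLoad]
    simp only [pathPrice_mul_boughtFrequency (hw _ _) (hpos _ _)]
  have hslack : ∀ ℓ k, Λ ℓ k * (c ℓ * f k - edgeLoad R (boughtFrequency R w Λ) ℓ k) = 0 := by
    refine eq_zero_of_sum_sum_nonpos
      (fun ℓ k => mul_nonneg (hΛ.1 ℓ k) (sub_nonneg.2 (hcap ℓ k))) ?_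
    simp only [mul_sub, Finset.sum_sub_distrib, hpaid]
    exact sub_nonpos.2 hΛ.2
  exact isOptimalPrice_of_edgeLoad_boughtFrequency_le hR hw hΛ.1 hpos hcap
    fun ℓ k => by linarith [hslack ℓ k]

lemma isOptimalPrice_zero (hR : ∀ k ℓ p, 0 ≤ R k ℓ p) (hcf : ∀ ℓ k, 0 ≤ c ℓ * f k) :
    IsOptimalPrice R c 0 f 0 :=
  isOptimalPrice_of_edgeLoad_boughtFrequency_le hR (fun _ _ => le_rfl) (fun _ _ => le_rfl)
    (fun _ _ h => absurd h (lt_irrefl 0))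
    (fun ℓ k => by simpa [edgeLoad, boughtFrequency] using hcf ℓ k) (by simp)

lemma exists_isOptimalPrice (hR : ∀ k ℓ p, 0 ≤ R k ℓ p) (hcf : ∀ ℓ k, 0 < c ℓ * f k)
    (hw : ∀ p k, 0 ≤ w p k) {Λ₀ : L → K → ℝ} (hΛ₀ : ∀ ℓ k, 0 ≤ Λ₀ ℓ k)
    (hpos₀ : ∀ p k, 0 < w p k → 0 < pathPrice R Λ₀ p k) : ∃ Λ, IsOptimalPrice R c w f Λ := by
  rcases (sum_sum_nonneg hw).eq_or_lt with hW | hW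
  · obtain rfl : w = 0 := funext₂ (eq_zero_of_sum_sum_nonpos hw hW.symm.le)
    exact ⟨0, isOptimalPrice_zero hR fun ℓ k => (hcf ℓ k).le⟩
  · obtain ⟨Λ, hΛ, hpos, hfair⟩ :=
      exists_mem_budgetSet_forall_sum_mul_edgeLoad_le hR hcf hw hW hΛ₀ hpos₀
    exact ⟨Λ, isOptimalPrice_of_forall_sum_mul_edgeLoad_le hR hcf hw hW hΛ hpos hfair⟩

end Existence

section Dissipation

variable {L P K : Type*} [Fintype L] [Fintype P]

/-- Defect of `Λ` as a vector of multipliers at `x`: a stationarity part and a slackness part.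
The squared stationarity defect `(μ x - w)²` is dissipated at the rate `(μ x - w)² / (μ x)`, which
is not continuous at `μ x = 0`; the larger denominator `1 + (μ x)²` makes the gap continuous. -/
noncomputable def optimalityGap [Fintype K] (R : K → Matrix L P ℝ) (c : L → ℝ) (w : P → K → ℝ)
    (f : K → ℝ) (x : P → K → ℝ) (Λ : L → K → ℝ) : ℝ :=
  ∑ p, ∑ k, (pathPrice R Λ p k * x p k - w p k) ^ 2 / (1 + (pathPrice R Λ p k * x p k) ^ 2) +
    ∑ ℓ, ∑ k, Λ ℓ k * (c ℓ * f k - edgeLoad R x ℓ k)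

lemma continuous_optimalityGap [Fintype K] (R : K → Matrix L P ℝ) (c : L → ℝ) (w : P → K → ℝ)
    (f : K → ℝ) (x : P → K → ℝ) : Continuous (optimalityGap R c w f x) := by
  have hμ : ∀ p k, Continuous fun Λ => pathPrice R Λ p k := fun p k =>
    (continuous_apply_apply p k).comp (continuous_pathPrice R)
  unfold optimalityGap
  refine .add (continuous_finsetSum _ fun p _ => continuous_finsetSum _ fun k _ => ?_)
    (by fun_prop)
  exact .div (by fun_prop) (by fun_prop) fun Λ => by positivity

variable {R : K → Matrix L P ℝ} {c : L → ℝ} {w : P → K → ℝ} {f : K → ℝ} {x : P → K → ℝ}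
  {Λ Λ' : L → K → ℝ}

lemma optimalityGap_nonneg [Fintype K] (hx : IsFeasible R c w f x) (hΛ : ∀ ℓ k, 0 ≤ Λ ℓ k) :
    0 ≤ optimalityGap R c w f x Λ :=
  add_nonneg (sum_sum_nonneg fun p k => by positivity)
    (sum_sum_nonneg fun ℓ k => mul_nonneg (hΛ ℓ k) (sub_nonneg.2 (hx.capacity ℓ k)))

lemma isMultiplier_of_optimalityGap_nonpos [Fintype K] (hx : IsFeasible R c w f x)
    (hΛ : ∀ ℓ k, 0 ≤ Λ ℓ k) (hgap : optimalityGap R c w f x Λ ≤ 0) :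
    IsMultiplier R c w f x Λ := by
  have hstat : ∀ p k, 0 ≤ (pathPrice R Λ p k * x p k - w p k) ^ 2 /
      (1 + (pathPrice R Λ p k * x p k) ^ 2) := fun p k => by positivity
  have hslack : ∀ ℓ k, 0 ≤ Λ ℓ k * (c ℓ * f k - edgeLoad R x ℓ k) := fun ℓ k =>
    mul_nonneg (hΛ ℓ k) (sub_nonneg.2 (hx.capacity ℓ k))
  unfold optimalityGap at hgap
  refine ⟨hΛ, fun p k => ?_, fun ℓ k => ?_⟩
  · have h := eq_zero_of_sum_sum_nonpos hstat (by linarith [sum_sum_nonneg hslack]) p k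
    have hden : 1 + (pathPrice R Λ p k * x p k) ^ 2 ≠ 0 := by positivity
    have hsq := (div_eq_zero_iff.1 h).resolve_right hden
    exact sub_eq_zero.1 ((pow_eq_zero_iff two_ne_zero).1 hsq)
  · linarith [eq_zero_of_sum_sum_nonpos hslack (by linarith [sum_sum_nonneg hstat]) ℓ k]

/-- Quantitative monotonicity of the demand `μ ↦ w / μ`, one of the two demands being `x`. -/
lemma sub_mul_div_sub_le_neg {w μ μ' x : ℝ} (hw : 0 ≤ w) (hμ : 0 ≤ μ) (hx : 0 ≤ x)
    (hstat : μ' * x = w) (hpos : 0 < w → 0 < μ) :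
    (μ - μ') * (w / μ - x) ≤ -((μ * x - w) ^ 2 / (1 + (μ * x) ^ 2)) := by
  have hμx : 0 ≤ μ * x := mul_nonneg hμ hx
  have hden : μ * x ≤ 1 + (μ * x) ^ 2 := by nlinarith [sq_nonneg (μ * x - 1)]
  have hden0 : 0 < 1 + (μ * x) ^ 2 := by positivity
  suffices (μ * x - w) ^ 2 / (1 + (μ * x) ^ 2) ≤ (μ - μ') * (x - w / μ) by linarith
  rcases hw.eq_or_lt with rfl | h
  · rw [zero_div, sub_zero, sub_zero, sub_mul, hstat, sub_zero, div_le_iff₀ hden0, pow_two]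
    exact mul_le_mul_of_nonneg_left (by linarith) hμx
  · have hμ0 := hpos h
    have hx0 : 0 < x := hx.lt_of_ne' fun h0 => h.ne' (by rw [← hstat, h0, mul_zero])
    calc (μ * x - w) ^ 2 / (1 + (μ * x) ^ 2) ≤ (μ * x - w) ^ 2 / (μ * x) :=
          div_le_div_of_nonneg_left (sq_nonneg _) (mul_pos hμ0 hx0) hden
      _ = (μ - μ') * (x - w / μ) := by
          rw [← hstat]
          field_simp

lemma sub_mul_priceVelocity_le {ℓ : L} {k : K} (hΛ : 0 ≤ Λ ℓ k) (hΛ' : 0 ≤ Λ' ℓ k) :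
    (Λ ℓ k - Λ' ℓ k) * priceVelocity R c w f Λ ℓ k ≤
      (Λ ℓ k - Λ' ℓ k) * (edgeLoad R (boughtFrequency R w Λ) ℓ k - c ℓ * f k) := by
  unfold priceVelocity
  split_ifs with hpos
  · exact le_rfl
  · rw [le_antisymm (not_lt.1 hpos) hΛ]
    exact mul_le_mul_of_nonpos_left (le_max_right _ _) (by linarith)

lemma IsMultiplier.sum_sub_mul_priceVelocity_le [Fintype K] (hm : IsMultiplier R c w f x Λ')
    (hR : ∀ k ℓ p, 0 ≤ R k ℓ p) (hw : ∀ p k, 0 ≤ w p k) (hx : ∀ p k, 0 ≤ x p k)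
    (hΛ : ∀ ℓ k, 0 ≤ Λ ℓ k) (hpos : ∀ p k, 0 < w p k → 0 < pathPrice R Λ p k) :
    ∑ ℓ, ∑ k, (Λ ℓ k - Λ' ℓ k) * priceVelocity R c w f Λ ℓ k ≤ -optimalityGap R c w f x Λ := by
  set y := boughtFrequency R w Λ
  have hvelocity : ∀ ℓ k, (Λ ℓ k - Λ' ℓ k) * priceVelocity R c w f Λ ℓ k ≤
      (Λ - Λ') ℓ k * edgeLoad R (y - x) ℓ k - Λ ℓ k * (c ℓ * f k - edgeLoad R x ℓ k) := by
    intro ℓ k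
    rw [edgeLoad_sub, Pi.sub_apply, Pi.sub_apply]
    linarith [sub_mul_priceVelocity_le (R := R) (c := c) (w := w) (f := f) (hΛ ℓ k)
      (hm.nonneg ℓ k), hm.slackness ℓ k]
  have hdemand : ∀ p k, pathPrice R (Λ - Λ') p k * (y - x) p k ≤
      -((pathPrice R Λ p k * x p k - w p k) ^ 2 / (1 + (pathPrice R Λ p k * x p k) ^ 2)) := by
    intro p k
    rw [(isLinearMap_pathPrice R).map_sub]
    exact sub_mul_div_sub_le_neg (hw p k) (pathPrice_nonneg hR hΛ p k) (hx p k)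
      (hm.stationarity p k) (hpos p k)
  calc ∑ ℓ, ∑ k, (Λ ℓ k - Λ' ℓ k) * priceVelocity R c w f Λ ℓ k
      ≤ ∑ ℓ, ∑ k, ((Λ - Λ') ℓ k * edgeLoad R (y - x) ℓ k -
          Λ ℓ k * (c ℓ * f k - edgeLoad R x ℓ k)) :=
        Finset.sum_le_sum fun ℓ _ => Finset.sum_le_sum fun k _ => hvelocity ℓ k
    _ = ∑ p, ∑ k, pathPrice R (Λ - Λ') p k * (y - x) p k -
          ∑ ℓ, ∑ k, Λ ℓ k * (c ℓ * f k - edgeLoad R x ℓ k) := by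
        simp only [Finset.sum_sub_distrib, sum_mul_edgeLoad]
    _ ≤ -optimalityGap R c w f x Λ := by
        rw [optimalityGap, neg_add, ← sub_eq_add_neg]
        simp only [← Finset.sum_neg_distrib]
        exact sub_le_sub_right
          (Finset.sum_le_sum fun p _ => Finset.sum_le_sum fun k _ => hdemand p k) _

end Dissipation

section Lyapunov

variable {L K : Type*} [Fintype L] [Fintype K]

lemma continuous_lyapunov (Λ' : L → K → ℝ) : Continuous (lyapunov Λ') := by
  unfold lyapunov
  fun_prop

lemma lyapunov_nonneg (Λ' Λ : L → K → ℝ) : 0 ≤ lyapunov Λ' Λ := by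
  unfold lyapunov
  positivity

lemma lyapunov_self (Λ : L → K → ℝ) : lyapunov Λ Λ = 0 := by
  simp [lyapunov]

lemma dist_le_sqrt_lyapunov (Λ' Λ : L → K → ℝ) : dist Λ Λ' ≤ √(2 * lyapunov Λ' Λ) := by
  refine (dist_pi_le_iff (Real.sqrt_nonneg _)).2 fun ℓ =>
    (dist_pi_le_iff (Real.sqrt_nonneg _)).2 fun k => ?_
  rw [Real.dist_eq, lyapunov, ← mul_assoc, mul_one_div_cancel two_ne_zero, one_mul]
  exact Real.abs_le_sqrt (le_sum_sum (a := fun ℓ k => (Λ ℓ k - Λ' ℓ k) ^ 2)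
    (fun _ _ => sq_nonneg _) ℓ k)

lemma absolutelyContinuousOnInterval_lyapunov (Λ' : L → K → ℝ) {Λ : ℝ → L → K → ℝ} {a b : ℝ}
    (hΛ : ∀ ℓ k, AbsolutelyContinuousOnInterval (fun t => Λ t ℓ k) a b) :
    AbsolutelyContinuousOnInterval (fun t => lyapunov Λ' (Λ t)) a b := by
  have hsq : ∀ ℓ k, AbsolutelyContinuousOnInterval (fun t => (Λ t ℓ k - Λ' ℓ k) ^ 2) a b := by
    intro ℓ k
    have h := (hΛ ℓ k).sub (absolutelyContinuousOnInterval_const a b (Λ' ℓ k))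
    simpa only [pow_two, Pi.sub_apply] using h.fun_mul h
  exact (absolutelyContinuousOnInterval_sum _ fun ℓ _ =>
    absolutelyContinuousOnInterval_sum _ fun k _ => hsq ℓ k).const_mul (1 / 2)

lemma hasDerivAt_lyapunov (Λ' : L → K → ℝ) {Λ : ℝ → L → K → ℝ} {v : L → K → ℝ} {t : ℝ}
    (hΛ : ∀ ℓ k, HasDerivAt (fun s => Λ s ℓ k) (v ℓ k) t) :
    HasDerivAt (fun s => lyapunov Λ' (Λ s)) (∑ ℓ, ∑ k, (Λ t ℓ k - Λ' ℓ k) * v ℓ k) t := by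
  have hsq : ∀ ℓ k, HasDerivAt (fun s => (Λ s ℓ k - Λ' ℓ k) ^ 2)
      (2 * ((Λ t ℓ k - Λ' ℓ k) * v ℓ k)) t := fun ℓ k => by
    simpa [mul_assoc] using ((hΛ ℓ k).sub_const (Λ' ℓ k)).fun_pow 2
  have h := (HasDerivAt.fun_sum fun ℓ (_ : ℓ ∈ Finset.univ) =>
    HasDerivAt.fun_sum fun k (_ : k ∈ Finset.univ) => hsq ℓ k).const_mul (1 / 2)
  refine h.congr_deriv ?_
  simp only [← Finset.mul_sum]
  ring

end Lyapunov

section Trajectory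

variable {L P K : Type*} [Fintype L] [Fintype P] [Fintype K] {R : K → Matrix L P ℝ} {c : L → ℝ}
  {w : P → K → ℝ} {f : K → ℝ} {Λ : ℝ → L → K → ℝ} {Λ' : L → K → ℝ}

lemma IsPriceTrajectory.absolutelyContinuous_lyapunov (hΛ : IsPriceTrajectory R c w f Λ)
    (Λ' : L → K → ℝ) {T : ℝ} (hT : 0 ≤ T) :
    AbsolutelyContinuousOnInterval (fun t => lyapunov Λ' (Λ t)) 0 T :=
  absolutelyContinuousOnInterval_lyapunov Λ' (hΛ.absolutelyContinuous T hT)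

lemma IsPriceTrajectory.ae_deriv_lyapunov_le (hΛ : IsPriceTrajectory R c w f Λ)
    (hR : ∀ k ℓ p, 0 ≤ R k ℓ p) (hw : ∀ p k, 0 ≤ w p k) {x : P → K → ℝ}
    (hx : ∀ p k, 0 ≤ x p k) (hm : IsMultiplier R c w f x Λ') :
    ∀ᵐ t : ℝ, 0 < t →
      deriv (fun s => lyapunov Λ' (Λ s)) t ≤ -optimalityGap R c w f x (Λ t) := by
  filter_upwards [hΛ.defined, hΛ.hasDerivAt] with t hpos hderiv ht
  rw [(hasDerivAt_lyapunov Λ' (hderiv ht)).deriv]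
  exact hm.sum_sub_mul_priceVelocity_le hR hw hx (hΛ.nonneg t ht.le) (hpos ht)

lemma IsPriceTrajectory.antitoneOn_lyapunov (hΛ : IsPriceTrajectory R c w f Λ)
    (hR : ∀ k ℓ p, 0 ≤ R k ℓ p) (hw : ∀ p k, 0 ≤ w p k) (hΛ' : IsOptimalPrice R c w f Λ') :
    AntitoneOn (fun t => lyapunov Λ' (Λ t)) (Ici 0) := by
  obtain ⟨x, hx, hm⟩ := isOptimalPrice_iff_exists_isMultiplier.1 hΛ'
  refine antitoneOn_Ici_of_ae_deriv_nonpos (fun T => hΛ.absolutelyContinuous_lyapunov Λ') ?_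
  filter_upwards [hΛ.ae_deriv_lyapunov_le hR hw hx.1.nonneg hm] with t hderiv ht
  exact (hderiv ht).trans (neg_nonpos.2 (optimalityGap_nonneg hx.1 (hΛ.nonneg t ht.le)))

lemma isCompact_closure_image_of_antitoneOn_lyapunov
    (hanti : AntitoneOn (fun t => lyapunov Λ' (Λ t)) (Ici 0)) :
    IsCompact (closure (Λ '' Ici 0)) := by
  refine (Metric.isBounded_closedBall (x := Λ') (r := √(2 * lyapunov Λ' (Λ 0)))).subset ?_
    |>.isCompact_closure
  rintro - ⟨t, ht, rfl⟩
  refine (dist_le_sqrt_lyapunov Λ' (Λ t)).trans (Real.sqrt_le_sqrt ?_)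
  exact mul_le_mul_of_nonneg_left (hanti self_mem_Ici ht ht) zero_le_two

lemma IsPriceTrajectory.exists_isOptimalPrice_mem_closure (hΛ : IsPriceTrajectory R c w f Λ)
    (hR : ∀ k ℓ p, 0 ≤ R k ℓ p) (hw : ∀ p k, 0 ≤ w p k) (hΛ' : IsOptimalPrice R c w f Λ') :
    ∃ Λbar ∈ closure (Λ '' Ici 0), IsOptimalPrice R c w f Λbar := by
  have hcompact := isCompact_closure_image_of_antitoneOn_lyapunov (hΛ.antitoneOn_lyapunov hR hw hΛ')
  obtain ⟨x, hx, hm⟩ := isOptimalPrice_iff_exists_isMultiplier.1 hΛ'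
  obtain ⟨Λbar, hmem, hmin⟩ := hcompact.exists_isMinOn
    (nonempty_Ici.image Λ).closure (continuous_optimalityGap R c w f x).continuousOn
  have hnonneg : ∀ ℓ k, 0 ≤ Λbar ℓ k :=
    closure_minimal (t := Ici (0 : L → K → ℝ)) (image_subset_iff.2 fun t ht => hΛ.nonneg t ht)
      isClosed_Ici hmem
  have hgap : optimalityGap R c w f x Λbar ≤ 0 := by
    refine le_of_forall_pos_le_add fun ε hε => ?_
    obtain ⟨t, ht, hlt⟩ := exists_lt_of_ae_deriv_le_neg
      (fun T => hΛ.absolutelyContinuous_lyapunov Λ') (fun t _ => lyapunov_nonneg Λ' (Λ t))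
      (hΛ.ae_deriv_lyapunov_le hR hw hx.1.nonneg hm) hε
    linarith [isMinOn_iff.1 hmin (Λ t) (subset_closure (mem_image_of_mem Λ ht))]
  exact ⟨Λbar, hmem, isOptimalPrice_iff_exists_isMultiplier.2
    ⟨x, hx, isMultiplier_of_optimalityGap_nonpos hx.1 hnonneg hgap⟩⟩

lemma IsPriceTrajectory.tendsto_of_mem_closure (hΛ : IsPriceTrajectory R c w f Λ)
    (hR : ∀ k ℓ p, 0 ≤ R k ℓ p) (hw : ∀ p k, 0 ≤ w p k) (hΛ' : IsOptimalPrice R c w f Λ')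
    (hmem : Λ' ∈ closure (Λ '' Ici 0)) : Tendsto Λ atTop (𝓝 Λ') := by
  have hV := tendsto_of_antitoneOn_of_mem_closure (continuous_lyapunov Λ')
    (fun Γ => by simpa only [lyapunov_self] using lyapunov_nonneg Λ' Γ)
    (hΛ.antitoneOn_lyapunov hR hw hΛ') hmem
  rw [lyapunov_self] at hV
  refine tendsto_iff_dist_tendsto_zero.2 (squeeze_zero (fun _ => dist_nonneg)
    (fun t => dist_le_sqrt_lyapunov Λ' (Λ t)) ?_)
  simpa only [mul_zero, Real.sqrt_zero] using (hV.const_mul 2).sqrt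

omit [Fintype K] in
lemma IsPriceTrajectory.exists_pathPrice_pos (hΛ : IsPriceTrajectory R c w f Λ) :
    ∃ t, 0 < t ∧ ∀ p k, 0 < w p k → 0 < pathPrice R (Λ t) p k := by
  have hfreq : ∃ᵐ t : ℝ, t ∈ Ioi (0 : ℝ) := frequently_ae_mem_iff.2 (by simp)
  obtain ⟨t, ht, hpos⟩ := (hfreq.and_eventually hΛ.defined).exists
  exact ⟨t, ht, hpos ht⟩

end Trajectory

end LinePlanning

open LinePlanning in
theorem mainTheorem3_general {L P K : Type*} [Fintype L] [Fintype P] [Fintype K]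
    (R : K → Matrix L P ℝ) (hR : ∀ k ℓ p, 0 ≤ R k ℓ p)
    (c : L → ℝ) (f : K → ℝ) (hcf : ∀ ℓ k, 0 < c ℓ * f k)
    (w : P → K → ℝ) (hw : ∀ p k, 0 ≤ w p k)
    (Λ : ℝ → L → K → ℝ) (hΛ : IsPriceTrajectory R c w f Λ) :
    (∃ Λbar : L → K → ℝ, IsOptimalPrice R c w f Λbar ∧
      Filter.Tendsto Λ Filter.atTop (nhds Λbar)) ∧
    ∀ Λbar : L → K → ℝ, IsOptimalPrice R c w f Λbar →
      AntitoneOn (fun t => lyapunov Λbar (Λ t)) (Set.Ici 0) := by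
  refine ⟨?_, fun Λbar => hΛ.antitoneOn_lyapunov hR hw⟩
  obtain ⟨t₀, ht₀, hpos⟩ := hΛ.exists_pathPrice_pos
  obtain ⟨Λ', hΛ'⟩ := exists_isOptimalPrice hR hcf hw (hΛ.nonneg t₀ ht₀.le) hpos
  obtain ⟨Λbar, hmem, hopt⟩ := hΛ.exists_isOptimalPrice_mem_closure hR hw hΛ'
  exact ⟨Λbar, hopt, hΛ.tendsto_of_mem_closure hR hw hopt hmem⟩

theorem mainTheorem3 {L P K : Type*} [Fintype L] [Fintype P] [Fintype K]
    (R : K → Matrix L P ℝ) (hR : ∀ k ℓ p, R k ℓ p = 0 ∨ R k ℓ p = 1)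
    (c : L → ℝ) (hc : ∀ ℓ, 0 < c ℓ)
    (w : P → K → ℝ) (hw : ∀ p k, 0 ≤ w p k)
    (f : K → ℝ) (hf : ∀ k, 0 < f k)
    (Λ : ℝ → L → K → ℝ) (hΛ : LinePlanning.IsPriceTrajectory R c w f Λ) :
    (∃ Λbar : L → K → ℝ, LinePlanning.IsOptimalPrice R c w f Λbar ∧
      Filter.Tendsto Λ Filter.atTop (nhds Λbar)) ∧
    ∀ Λbar : L → K → ℝ, LinePlanning.IsOptimalPrice R c w f Λbar →
      AntitoneOn (fun t => LinePlanning.lyapunov Λbar (Λ t)) (Set.Ici 0) :=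
  mainTheorem3_general R (fun k ℓ p => by rcases hR k ℓ p with h | h <;> simp [h]) c f
    (fun ℓ k => mul_pos (hc ℓ) (hf k)) w hw Λ hΛ
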